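/- Let $m,n\ge 1$ be fixed integers. For every integer $d\ge 1$ let $G=G_d$ be a random $dn\times dm$ matrix whose entries are i.i.d. standard complex Gaussian variables (real and imaginary parts independent, centered, of variance $1/2$). Let $W=W_d=(dm)^{-1}GG^*$ be the corresponding complex Wishart matrix of parameters $(dn,dm)$. Index the rows and columns of $W$ by pairs $(i,a)$ with $1\le i\le d$ and $1\le a\le n$, and let $W^\Gamma$ be the partial transpose of $W$, given by $W^\Gamma_{ia,jb}=W_{ib,ja}$. Let $\mathrm{tr}=(dn)^{-1}\mathrm{Tr}$ be the normalized trace on $dn\times dn$ matrices. Then for every integer $p\ge 1$ the random variable $\mathrm{tr}\big((mW^\Gamma)^p\big)$ is integrable for every $d$, and $$\lim_{d\to\infty}\mathbb E\,\mathrm{tr}\big((mW^\Gamma)^p\big)=\sum_{\pi\in NC(p)}m^{\#\pi}\,n^{e(\pi)},$$ where $NC(p)$ is the set of noncrossing partitions of $\{1,\dots,p\}$, $\#\pi$ is the number of blocks of $\pi$, and $e(\pi)$ is the number of blocks of $\pi$ of even size. -/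

import Mathlib

open MeasureTheory ProbabilityTheory Filter Topology
open scoped Matrix NNReal

noncomputable section

/-- The standard complex Gaussian law `N(0,1)` on `ℂ`: the law of `x + i y`, where `x` and `y` are
independent real centered Gaussian variables of variance `1/2`, so that `E |z|^2 = 1`. -/
def stdComplexGaussian : Measure ℂ :=
  ((gaussianReal 0 (1 / 2 : ℝ≥0)).prod (gaussianReal 0 (1 / 2 : ℝ≥0))).map
    (fun x : ℝ × ℝ => (⟨x.1, x.2⟩ : ℂ))

/-- `G` is a random matrix with i.i.d. standard complex Gaussian entries. -/
structure IsComplexGaussianMatrix {Ω ι κ : Type*} [MeasurableSpace Ω]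
    (G : Ω → Matrix ι κ ℂ) (P : Measure Ω) : Prop where
  hasLaw : ∀ i j, HasLaw (fun ω => G ω i j) stdComplexGaussian P
  indep : iIndepFun (fun (ij : ι × κ) (ω : Ω) => G ω ij.1 ij.2) P

/-- The matrix `N⁻¹ G G^*`, where `N` is the number of columns of `G`. It is a complex Wishart
matrix when `G` has i.i.d. standard complex Gaussian entries. -/
def wishart {ι κ : Type*} [Fintype κ] (G : Matrix ι κ ℂ) : Matrix ι ι ℂ :=
  (Fintype.card κ : ℂ)⁻¹ • (G * Gᴴ)

/-- The partial (block) transpose: `(partialTranspose W)_{ia,jb} = W_{ib,ja}`. -/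
def partialTranspose {α β : Type*} (W : Matrix (α × β) (α × β) ℂ) :
    Matrix (α × β) (α × β) ℂ :=
  Matrix.of fun x y => W (x.1, y.2) (y.1, x.2)

/-- The normalized trace of a square matrix. -/
def normalizedTrace {ι : Type*} [Fintype ι] (A : Matrix ι ι ℂ) : ℂ :=
  (Fintype.card ι : ℂ)⁻¹ * A.trace

end

/-- A partition `π` of `{0, …, p-1}` is noncrossing if there are no `a < b < c < d` with `a, c` in
one block of `π` and `b, d` in another one. -/
def IsNoncrossing {p : ℕ} (π : Finpartition (Finset.univ : Finset (Fin p))) : Prop :=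
  ∀ B ∈ π.parts, ∀ C ∈ π.parts, ∀ a ∈ B, ∀ b ∈ C, ∀ c ∈ B, ∀ d ∈ C,
    a < b → b < c → c < d → B = C

instance {p : ℕ} : DecidablePred (IsNoncrossing (p := p)) := fun _ => by
  unfold IsNoncrossing; infer_instance

/-- The finite set `NC(p)` of noncrossing partitions of a totally ordered set with `p` elements. -/
def NC (p : ℕ) : Finset (Finpartition (Finset.univ : Finset (Fin p))) :=
  Finset.univ.filter IsNoncrossing

/-- The number of blocks of even size of `π`. -/
def evenBlocks {p : ℕ} (π : Finpartition (Finset.univ : Finset (Fin p))) : ℕ :=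
  (π.parts.filter fun B => Even B.card).card

/-! Put `p = q + 1` and let `γ = finRotate p` be the full cycle. Expanding the trace over closed
paths and applying Wick's formula (`integral_prod_mul_conj`) gives a sum over permutations `τ`.
Counting the index families compatible with `τ` (`card_index_families`) gives the weight `d ^
#(τ⁻¹γ) * n ^ #(γτ) * (dm) ^ #τ`, where `#` counts cycles; the prefactor is `(dn)⁻¹ * d ^ (-p)`.

The exponent of `d` is thus `#τ + #(τ⁻¹γ) - (p + 1)`. By the triangle inequality for the length `p -
#σ`, it is at most `0`, with equality exactly when `τ` lies on a geodesic from `1` to `γ`. Only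
these `τ` survive in the limit, and they correspond to the noncrossing partitions through their
cycles (`sum_isGeodesic_eq_sum_NC`).

The power of `n` comes from `numCycles_mul_mul_of_geodesic`. With `κ = τ⁻¹γ`, one has `γτ = τκτ`.
For `κ = 1` this is `τ²`, which has `#τ + e(τ)` cycles because squaring splits exactly the even
cycles. Building `κ` up by transpositions along the geodesic lowers `#(τκ)` and `#(τκτ)` by one each
time, so `#(γτ) - #γ = e(τ)` at the end. The extra factor `n` due to `#γ = 1` is cancelled by the
normalization of the trace. -/

namespace Equiv.Perm

/-! ### Counting cycles, and multiplication by a transposition -/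

variable {α : Type*}

/-- A function that is invariant under a permutation is constant on its cycles. -/
theorem SameCycle.apply_eq_of_invariant {β : Type*} {σ : Perm α} {f : α → β}
    (hf : ∀ x, f (σ x) = f x) {x y : α} (h : SameCycle σ x y) : f x = f y := by
  obtain ⟨k, rfl⟩ := h
  induction k using Int.induction_on with
  | zero => simp
  | succ k ih => rw [ih, add_comm, zpow_one_add, mul_apply, hf]
  | pred k ih =>
    rw [ih, sub_eq_neg_add, zpow_add, mul_apply, zpow_neg_one]
    have := hf (σ⁻¹ ((σ ^ (-(k : ℤ))) x))
    rwa [show σ (σ⁻¹ ((σ ^ (-(k : ℤ))) x)) = (σ ^ (-(k : ℤ))) x by simp] at this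

theorem SameCycle.iff_of_invariant {σ : Perm α} {s : α → Prop}
    (hs : ∀ x, s (σ x) ↔ s x) {x y : α} (h : SameCycle σ x y) : s x ↔ s y :=
  iff_of_eq (h.apply_eq_of_invariant fun x => propext (hs x))

/-- On a finite type, a forward invariant set is invariant. -/
theorem apply_mem_iff_of_forall_mem [Finite α] {σ : Perm α} {s : α → Prop}
    (hs : ∀ x, s x → s (σ x)) (x : α) : s (σ x) ↔ s x := by
  refine ⟨fun h => ?_, hs x⟩
  have key : ∀ k : ℕ, s ((σ ^ k) (σ x)) := fun k => by
    induction k with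
    | zero => simpa
    | succ k ih => rw [pow_succ', mul_apply]; exact hs _ ih
  have h1 := key (orderOf σ - 1)
  rwa [← mul_apply, ← pow_succ, Nat.sub_add_cancel (orderOf_pos σ), pow_orderOf_eq_one,
    one_apply] at h1

theorem SameCycle.mem_iff_of_forall_mem [Finite α] {σ : Perm α} {s : α → Prop}
    (hs : ∀ x, s x → s (σ x)) {x y : α} (h : SameCycle σ x y) : s x ↔ s y :=
  h.iff_of_invariant (apply_mem_iff_of_forall_mem hs)

/-- A permutation that stays inside the classes of an equivalence relation has its cycles inside
these classes. -/
theorem SameCycle.rel_of_forall {σ : Perm α} (r : Setoid α) (hr : ∀ x, r x (σ x)) {x y : α}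
    (h : SameCycle σ x y) : r x y :=
  Quotient.exact (h.apply_eq_of_invariant (f := fun x => (Quotient.mk r x))
    fun x => Quotient.sound (r.symm (hr x)))

/-- The number of cycles of a permutation, fixed points included. -/
noncomputable def numCycles (σ : Perm α) : ℕ := Nat.card (Quotient (SameCycle.setoid σ))

theorem mk_eq_mk_iff_sameCycle {σ : Perm α} {x y : α} :
    (Quotient.mk (SameCycle.setoid σ) x) = (Quotient.mk (SameCycle.setoid σ) y) ↔
      SameCycle σ x y := by
  rw [Quotient.eq]; rfl

theorem numCycles_one : numCycles (1 : Perm α) = Nat.card α := by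
  refine (Nat.card_congr (Equiv.ofBijective (Quotient.mk (SameCycle.setoid (1 : Perm α)))
    ⟨fun x y h => ?_, Quotient.mk_surjective⟩)).symm
  rwa [mk_eq_mk_iff_sameCycle, sameCycle_one] at h

theorem numCycles_le_card [Finite α] (σ : Perm α) : numCycles σ ≤ Nat.card α :=
  Nat.card_le_card_of_surjective _ Quotient.mk_surjective

/-- The functions that are invariant under `σ` are the functions on its set of cycles. -/
theorem card_invariant_functions [Finite α] {β : Type*} (σ : Perm α) :
    Nat.card {f : α → β // f ∘ σ = f} = Nat.card β ^ numCycles σ := by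
  have e : {f : α → β // f ∘ σ = f} ≃ (Quotient (SameCycle.setoid σ) → β) :=
    { toFun := fun f => Quotient.lift f.1 fun _ _ h =>
        SameCycle.apply_eq_of_invariant (fun x => congrFun f.2 x) h
      invFun := fun g => ⟨fun x => g (Quotient.mk _ x), by
        funext x
        refine congrArg g (mk_eq_mk_iff_sameCycle.2 ?_)
        rw [sameCycle_apply_left]⟩
      left_inv := fun f => rfl
      right_inv := fun g => by
        funext q
        induction q using Quotient.inductionOn
        rfl }
  rw [Nat.card_congr e, Nat.card_fun, numCycles]

section Swap

variable [Finite α] [DecidableEq α]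

/-- The new permutation sends `a` to `σ b` and then follows the `σ`-cycle of `b`, which avoids `a`,
up to its first return to `b`. -/
theorem sameCycle_mul_swap {σ : Perm α} {a b : α} (h : ¬ SameCycle σ a b) :
    SameCycle (σ * swap a b) a b := by
  have hab : a ≠ b := fun e => h (e ▸ SameCycle.refl _ _)
  have hstep : (σ * swap a b) a = σ b := by simp
  have hex : ∃ k : ℕ, 0 < k ∧ (σ ^ k) b = b :=
    ⟨orderOf σ, orderOf_pos σ, by simp [pow_orderOf_eq_one]⟩
  classical
  obtain ⟨hk0, hk⟩ := Nat.find_spec hex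
  set k := Nat.find hex with hkdef
  have key : ∀ j : ℕ, j < k → ((σ * swap a b) ^ (j + 1)) a = (σ ^ (j + 1)) b := by
    intro j
    induction j with
    | zero => intro _; simp [hstep]
    | succ j ih =>
      intro hj
      rw [pow_succ', mul_apply, ih (by omega), mul_apply, swap_apply_of_ne_of_ne, ← mul_apply,
        ← pow_succ']
      · intro e
        exact h (SameCycle.symm ⟨((j + 1 : ℕ) : ℤ), by rw [zpow_natCast]; exact e⟩)
      · intro e
        exact Nat.find_min hex (m := j + 1) (by omega) ⟨by omega, e⟩
  refine ⟨(k : ℤ), ?_⟩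
  have := key (k - 1) (by omega)
  rw [Nat.sub_add_cancel hk0] at this
  rw [zpow_natCast, this, hk]

/-- The arc `σ b, σ² b, …, a` of the cycle closes up on itself under `σ * swap a b`, and it does not
contain `b`. -/
theorem not_sameCycle_mul_swap {σ : Perm α} {a b : α} (hab : a ≠ b) (h : SameCycle σ a b) :
    ¬ SameCycle (σ * swap a b) a b := by
  classical
  have hex : ∃ k : ℕ, 0 < k ∧ (σ ^ k) b = a := by
    obtain ⟨i, hi, _, h⟩ := h.symm.exists_pow_eq''
    exact ⟨i, hi, h⟩
  obtain ⟨hk0, hk⟩ := Nat.find_spec hex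
  set k := Nat.find hex with hkdef
  have hmin : ∀ j, 0 < j → j < k → (σ ^ j) b ≠ a := fun j hj hjk e =>
    Nat.find_min hex hjk ⟨hj, e⟩
  have hne : ∀ j, 0 < j → j ≤ k → (σ ^ j) b ≠ b := by
    intro j hj hjk e
    rcases hjk.eq_or_lt with rfl | hlt
    · exact hab (hk.symm.trans e)
    · refine hmin (k - j) (by omega) (by omega) ?_
      rw [← hk]
      conv_rhs => rw [← Nat.sub_add_cancel hjk, pow_add, mul_apply, e]
  let s : α → Prop := fun x => ∃ j, 0 < j ∧ j ≤ k ∧ (σ ^ j) b = x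
  have hs : ∀ x, s x → s ((σ * swap a b) x) := by
    rintro x ⟨j, hj, hjk, rfl⟩
    rcases hjk.eq_or_lt with rfl | hlt
    · exact ⟨1, one_pos, hk0, by simp [hk]⟩
    · refine ⟨j + 1, by omega, hlt, ?_⟩
      rw [mul_apply, swap_apply_of_ne_of_ne (hmin j hj hlt) (hne j hj hjk), pow_succ', mul_apply]
  intro hc
  obtain ⟨j, hj, hjk, e⟩ := (hc.mem_iff_of_forall_mem hs).1 ⟨k, hk0, le_rfl, hk⟩
  exact hne j hj hjk e

theorem SameCycle.mul_swap_of_not {σ : Perm α} {a b : α} (h : ¬ SameCycle σ a b) {x y : α}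
    (hxy : SameCycle σ x y) : SameCycle (σ * swap a b) x y := by
  have hab := sameCycle_mul_swap h
  refine hxy.rel_of_forall (SameCycle.setoid (σ * swap a b)) fun x => ?_
  change SameCycle _ _ _
  by_cases hxa : x = a
  · subst hxa
    refine hab.trans ?_
    have : σ x = (σ * swap x b) b := by simp
    rw [this, sameCycle_apply_right]
  by_cases hxb : x = b
  · subst hxb
    refine hab.symm.trans ?_
    have : σ x = (σ * swap a x) a := by simp
    rw [this, sameCycle_apply_right]
  have : σ x = (σ * swap a b) x := by rw [mul_apply, swap_apply_of_ne_of_ne hxa hxb]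
  rw [this, sameCycle_apply_right]

/-- The cycles of `a` and `b` merge and the others persist, so the cycles of `σ` other than that of
`b` biject with the new ones. The map `f`, which relabels the cycle of `b` as that of `a`, is
invariant under the new permutation and gives injectivity. -/
theorem numCycles_mul_swap_add_one {σ : Perm α} {a b : α} (h : ¬ SameCycle σ a b) :
    numCycles (σ * swap a b) + 1 = numCycles σ := by
  classical
  let Q := Quotient (SameCycle.setoid σ)
  let qb : Q := Quotient.mk _ b
  let f : α → Q := fun x => if SameCycle σ x b then Quotient.mk _ a else Quotient.mk _ x
  have hf : ∀ x, f ((σ * swap a b) x) = f x := by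
    intro x
    by_cases hxa : x = a
    · subst hxa
      have : SameCycle σ b b := SameCycle.refl _ _
      simp [f, this]
    by_cases hxb : x = b
    · subst hxb
      have : ¬ SameCycle σ (σ a) x := by rwa [sameCycle_apply_left]
      simp only [f, mul_apply, swap_apply_right, this, if_false, SameCycle.refl, if_true]
      rw [mk_eq_mk_iff_sameCycle, sameCycle_apply_left]
    · have e : (σ * swap a b) x = σ x := by rw [mul_apply, swap_apply_of_ne_of_ne hxa hxb]
      simp only [f, e, sameCycle_apply_left]
      split_ifs with h1
      · rfl
      · rw [mk_eq_mk_iff_sameCycle, sameCycle_apply_left]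
  let g : {q : Q // q ≠ qb} → Quotient (SameCycle.setoid (σ * swap a b)) := fun q =>
    Quotient.lift (fun x => Quotient.mk _ x)
      (fun x y hxy => mk_eq_mk_iff_sameCycle.2 (SameCycle.mul_swap_of_not h hxy)) q.1
  have hg : Function.Bijective g := by
    constructor
    · rintro ⟨x, hx⟩ ⟨y, hy⟩ hxy
      induction x using Quotient.inductionOn with | _ x => ?_
      induction y using Quotient.inductionOn with | _ y => ?_
      have hx' : ¬ SameCycle σ x b := fun h => hx (mk_eq_mk_iff_sameCycle.2 h)
      have hy' : ¬ SameCycle σ y b := fun h => hy (mk_eq_mk_iff_sameCycle.2 h)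
      have := (mk_eq_mk_iff_sameCycle.1 hxy).apply_eq_of_invariant hf
      simp only [f, hx', hy', if_false] at this
      exact Subtype.ext this
    · intro q
      induction q using Quotient.inductionOn with | _ x => ?_
      by_cases hx : SameCycle σ x b
      · refine ⟨⟨Quotient.mk _ a, fun e => h (mk_eq_mk_iff_sameCycle.1 e)⟩, ?_⟩
        exact mk_eq_mk_iff_sameCycle.2
          ((sameCycle_mul_swap h).trans (SameCycle.mul_swap_of_not h hx.symm))
      · exact ⟨⟨Quotient.mk _ x, fun e => hx (mk_eq_mk_iff_sameCycle.1 e)⟩, rfl⟩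
  have : Fintype Q := Fintype.ofFinite Q
  have hcard := Nat.card_congr (Equiv.ofBijective g hg)
  rw [Nat.card_eq_fintype_card, Fintype.card_subtype_compl, Fintype.card_subtype_eq] at hcard
  have hpos : 0 < Fintype.card Q := Fintype.card_pos_iff.2 ⟨qb⟩
  simp only [numCycles]
  rw [← hcard, Nat.card_eq_fintype_card]
  exact Nat.sub_add_cancel hpos

theorem numCycles_mul_swap {σ : Perm α} {a b : α} (hab : a ≠ b) (h : SameCycle σ a b) :
    numCycles (σ * swap a b) = numCycles σ + 1 := by
  have := numCycles_mul_swap_add_one (not_sameCycle_mul_swap hab h)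
  rw [mul_assoc, swap_mul_self, mul_one] at this
  exact this.symm

theorem numCycles_mul_swap_le (σ : Perm α) (a b : α) :
    numCycles (σ * swap a b) ≤ numCycles σ + 1 := by
  by_cases h : SameCycle σ a b
  · by_cases hab : a = b
    · subst hab; rw [swap_self]; exact Nat.le_succ _
    · exact (numCycles_mul_swap hab h).le
  · have := numCycles_mul_swap_add_one h
    omega

/-- Every permutation is built from the identity by transpositions that join two cycles. -/
theorem induction_on_mul_swap {P : Perm α → Prop} (one : P 1)
    (mul_swap : ∀ σ a b, ¬ SameCycle σ a b → P σ → P (σ * swap a b)) (σ : Perm α) : P σ := by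
  -- Cutting a nontrivial cycle between `a` and `σ a` lowers the length; the same transposition
  -- joins the pieces again.
  induction hk : Nat.card α - numCycles σ using Nat.strong_induction_on generalizing σ with
  | _ k ih =>
    by_cases h1 : σ = 1
    · exact h1 ▸ one
    · obtain ⟨a, ha⟩ : ∃ a, σ a ≠ a := by
        by_contra! h
        exact h1 (Equiv.ext h)
      have hs : SameCycle σ a (σ a) := by rw [sameCycle_apply_right]
      have hn := numCycles_mul_swap ha.symm hs
      have hle := numCycles_le_card (σ * swap a (σ a))
      have := mul_swap _ a (σ a) (not_sameCycle_mul_swap ha.symm hs)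
        (ih _ (by omega) (σ * swap a (σ a)) rfl)
      rwa [mul_assoc, swap_mul_self, mul_one] at this

/-- The triangle inequality for the length `Nat.card α - numCycles σ`. -/
theorem numCycles_add_numCycles_le (σ τ : Perm α) :
    numCycles σ + numCycles τ ≤ Nat.card α + numCycles (σ * τ) := by
  induction τ using induction_on_mul_swap with
  | one => rw [numCycles_one, mul_one, add_comm]
  | mul_swap τ a b h ih =>
    have h1 := numCycles_mul_swap_add_one h
    have h2 := numCycles_mul_swap_le (σ * τ * swap a b) a b
    rw [mul_assoc _ (swap a b), swap_mul_self, mul_one, mul_assoc] at h2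
    omega

end Swap

end Equiv.Perm

/-! ### Cycle partitions, squares and geodesics -/

theorem Finpartition.sum_part {α M : Type*} [Fintype α] [DecidableEq α] [AddCommMonoid M]
    (P : Finpartition (Finset.univ : Finset α)) (f : Finset α → M) :
    ∑ x, f (P.part x) = ∑ B ∈ P.parts, B.card • f B := by
  rw [← Finset.sum_fiberwise_of_maps_to (t := P.parts) (g := P.part)
    fun x _ => P.part_mem.2 (Finset.mem_univ x)]
  refine Finset.sum_congr rfl fun B hB => ?_
  have : (Finset.univ.filter fun x => P.part x = B) = B := by
    ext x
    simp [P.part_eq_iff_mem hB]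
  rw [this, Finset.sum_congr rfl (g := fun _ => f B), Finset.sum_const]
  intro x hx
  rw [P.part_eq_of_mem hB hx]

theorem Finpartition.ext_part {α : Type*} [DecidableEq α] {s : Finset α}
    {P Q : Finpartition s} (h : ∀ x ∈ s, P.part x = Q.part x) : P = Q := by
  ext B
  constructor
  · intro hB
    obtain ⟨x, hx⟩ := P.nonempty_of_mem_parts hB
    have hxs := P.subset hB hx
    rw [← P.part_eq_of_mem hB hx, h x hxs]
    exact Q.part_mem.2 hxs
  · intro hB
    obtain ⟨x, hx⟩ := Q.nonempty_of_mem_parts hB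
    have hxs := Q.subset hB hx
    rw [← Q.part_eq_of_mem hB hx, ← h x hxs]
    exact P.part_mem.2 hxs

namespace Equiv.Perm

variable {α : Type*} [Fintype α] [DecidableEq α]

/-- The partition of a finite type into the cycles of a permutation. -/
noncomputable def cyclePartition (σ : Perm α) : Finpartition (Finset.univ : Finset α) :=
  @Finpartition.ofSetoid α _ _ (SameCycle.setoid σ) (Classical.decRel _)

theorem mem_part_cyclePartition {σ : Perm α} {x y : α} :
    y ∈ (cyclePartition σ).part x ↔ SameCycle σ x y := by
  unfold cyclePartition
  rw [@Finpartition.mem_part_ofSetoid_iff_rel]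
  rfl

theorem part_cyclePartition_eq_iff {σ : Perm α} {x y : α} :
    (cyclePartition σ).part x = (cyclePartition σ).part y ↔ SameCycle σ x y := by
  rw [← Finpartition.mem_part_iff_part_eq_part _ (Finset.mem_univ _) (Finset.mem_univ _),
    mem_part_cyclePartition, sameCycle_comm]

theorem card_parts_cyclePartition (σ : Perm α) :
    (cyclePartition σ).parts.card = numCycles σ := by
  rw [numCycles, ← Nat.card_eq_finsetCard]
  let f : Quotient (SameCycle.setoid σ) → (cyclePartition σ).parts :=
    Quotient.lift (fun x => ⟨(cyclePartition σ).part x,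
      (cyclePartition σ).part_mem.2 (Finset.mem_univ x)⟩)
      fun x y h => Subtype.ext (part_cyclePartition_eq_iff.2 h)
  refine (Nat.card_congr (Equiv.ofBijective f ⟨fun q r h => ?_, fun ⟨B, hB⟩ => ?_⟩)).symm
  · induction q using Quotient.inductionOn
    induction r using Quotient.inductionOn
    exact mk_eq_mk_iff_sameCycle.2 (part_cyclePartition_eq_iff.1 (congrArg Subtype.val h))
  · obtain ⟨x, hx⟩ := (cyclePartition σ).nonempty_of_mem_parts hB
    exact ⟨Quotient.mk _ x, Subtype.ext ((cyclePartition σ).part_eq_of_mem hB hx)⟩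

theorem card_part_cyclePartition (σ : Perm α) (x : α) :
    ((cyclePartition σ).part x).card = Function.minimalPeriod σ x := by
  classical
  have h := MulAction.minimalPeriod_eq_card (a := σ) (b := x)
  have e : (fun y => σ • y) = (σ : α → α) := rfl
  rw [e] at h
  rw [h, ← Fintype.card_coe]
  refine Fintype.card_congr (Equiv.subtypeEquivRight fun y => ?_)
  rw [mem_part_cyclePartition, MulAction.mem_orbit_iff]
  constructor
  · rintro ⟨k, hk⟩
    exact ⟨⟨σ ^ k, k, rfl⟩, hk⟩
  · rintro ⟨⟨_, k, rfl⟩, hk⟩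
    exact ⟨k, hk⟩

/-- The number of cycles of even length. -/
noncomputable def numEvenCycles (σ : Perm α) : ℕ :=
  ((cyclePartition σ).parts.filter fun B => Even B.card).card

/-- A cycle of length `k` receives `1/k` from each of its `k` points. Cycle counts become sums over
points, where periods of powers are easy to compare. -/
theorem numCycles_eq_sum_inv (σ : Perm α) :
    (numCycles σ : ℚ) = ∑ x, ((Function.minimalPeriod σ x : ℕ) : ℚ)⁻¹ := by
  simp_rw [← card_part_cyclePartition]
  rw [(cyclePartition σ).sum_part fun B => ((B.card : ℕ) : ℚ)⁻¹, ← card_parts_cyclePartition,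
    Finset.sum_congr rfl (g := fun _ => (1 : ℚ))]
  · simp
  · intro B hB
    have : (B.card : ℚ) ≠ 0 := by
      exact_mod_cast (Finset.card_pos.2 ((cyclePartition σ).nonempty_of_mem_parts hB)).ne'
    rw [nsmul_eq_mul, mul_inv_cancel₀ this]

/-- A point of period `k` has period `k / gcd k 2` under the square: even cycles split in two and
odd ones stay whole. -/
theorem numCycles_mul_self (σ : Perm α) :
    numCycles (σ * σ) = numCycles σ + numEvenCycles σ := by
  have hper : ∀ x, ((Function.minimalPeriod (σ * σ) x : ℕ) : ℚ)⁻¹ =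
      (fun B : Finset α => ((B.card : ℕ) : ℚ)⁻¹ * (1 + if Even B.card then 1 else 0))
        ((cyclePartition σ).part x) := by
    intro x
    have hpos : 0 < ((cyclePartition σ).part x).card :=
      Finset.card_pos.2 ((cyclePartition σ).part_nonempty.2 (Finset.mem_univ x))
    have e : ((σ * σ : Perm α) : α → α) = σ^[2] := rfl
    rw [e, Function.minimalPeriod_iterate_eq_div_gcd two_ne_zero, ← card_part_cyclePartition]
    dsimp only
    set k := ((cyclePartition σ).part x).card
    by_cases hk : Even k
    · have h2 : Nat.gcd k 2 = 2 := Nat.gcd_eq_right hk.two_dvd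
      simp only [h2, hk, if_true]
      rw [Nat.cast_div hk.two_dvd (by norm_num)]
      norm_num
      ring
    · have h2 : Nat.gcd k 2 = 1 := by
        rw [← Nat.coprime_iff_gcd_eq_one, Nat.coprime_two_right]
        exact Nat.not_even_iff_odd.1 hk
      simp [h2, hk]
  have : (numCycles (σ * σ) : ℚ) = numCycles σ + numEvenCycles σ := by
    rw [numCycles_eq_sum_inv, Finset.sum_congr rfl fun x _ => hper x,
      (cyclePartition σ).sum_part fun B : Finset α =>
        ((B.card : ℕ) : ℚ)⁻¹ * (1 + if Even B.card then 1 else 0),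
      ← card_parts_cyclePartition, numEvenCycles, Finset.sum_congr rfl
        (g := fun B => (1 : ℚ) + if Even B.card then 1 else 0)]
    · rw [Finset.sum_add_distrib]
      simp
    · intro B hB
      have : (B.card : ℚ) ≠ 0 := by
        exact_mod_cast (Finset.card_pos.2 ((cyclePartition σ).nonempty_of_mem_parts hB)).ne'
      rw [nsmul_eq_mul, mul_inv_cancel_left₀ this]
  exact_mod_cast this

/-- If `τ` and `κ` lie on a geodesic, i.e. if the lengths add up in `τ * κ`, then every cycle of `τ`
is contained in a cycle of `τ * κ`, and the number of cycles of `τ * κ * τ` is known. -/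
theorem numCycles_mul_mul_of_geodesic (τ κ : Perm α)
    (h : numCycles τ + numCycles κ = Nat.card α + numCycles (τ * κ)) :
    (∀ x, SameCycle (τ * κ) x (τ x)) ∧
      numCycles (τ * κ * τ) = numCycles (τ * κ) + numEvenCycles τ := by
  induction κ using induction_on_mul_swap with
  | one =>
    simp only [mul_one]
    exact ⟨fun x => by rw [sameCycle_apply_right], numCycles_mul_self τ⟩
  | mul_swap κ a b hab ih =>
    have h1 := numCycles_mul_swap_add_one hab
    have h2 := numCycles_add_numCycles_le τ κ
    have h3 := numCycles_mul_swap_le (τ * κ * swap a b) a b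
    rw [mul_assoc _ (swap a b), swap_mul_self, mul_one] at h3
    rw [← mul_assoc] at h ⊢
    -- Equality for `κ * swap a b` forces equality for `κ`, and it forces the transposition to join
    -- two cycles of `τ * κ` as well.
    obtain ⟨ih1, ih2⟩ := ih (by omega)
    have hne : a ≠ b := fun e => hab (e ▸ SameCycle.refl _ _)
    have hab' : ¬ SameCycle (τ * κ) a b := by
      intro hc
      have := numCycles_mul_swap hne hc
      omega
    refine ⟨fun x => (ih1 x).mul_swap_of_not hab', ?_⟩
    have e : τ * κ * swap a b * τ = τ * κ * τ * swap (τ⁻¹ a) (τ⁻¹ b) := by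
      have : swap (τ⁻¹ a) (τ⁻¹ b) = τ⁻¹ * swap a b * τ := by
        rw [mul_assoc, swap_mul_eq_mul_swap, inv_mul_cancel_left]
      rw [this]
      group
    have hsub : ∀ {x y}, SameCycle (τ * κ * τ) x y → SameCycle (τ * κ) x y := fun {x y} hxy =>
      hxy.rel_of_forall (SameCycle.setoid (τ * κ)) fun x => by
        change SameCycle _ _ _
        rw [mul_apply, sameCycle_apply_right]
        exact ih1 x
    -- Cycles of `τ * κ * τ` lie inside those of `τ * κ`, and `τ⁻¹ a`, `τ⁻¹ b` lie in the `τ *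
    -- κ`-cycles of `a`, `b`. So the conjugated transposition also joins two cycles.
    have hab'' : ¬ SameCycle (τ * κ * τ) (τ⁻¹ a) (τ⁻¹ b) := by
      intro hc
      have ha := ih1 (τ⁻¹ a)
      have hb := ih1 (τ⁻¹ b)
      rw [show τ (τ⁻¹ a) = a by simp] at ha
      rw [show τ (τ⁻¹ b) = b by simp] at hb
      exact hab' ((ha.symm.trans (hsub hc)).trans hb)
    have h4 := numCycles_mul_swap_add_one hab''
    rw [← e] at h4
    have h5 := numCycles_mul_swap_add_one hab'
    omega

end Equiv.Perm

/-! ### Geodesics to the full cycle are noncrossing -/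

namespace Equiv.Perm

theorem numCycles_conj {α : Type*} (σ τ : Perm α) :
    numCycles (τ * σ * τ⁻¹) = numCycles σ :=
  Nat.card_congr (Quotient.congr τ⁻¹ fun _ _ => sameCycle_conj)

theorem numCycles_mul_comm {α : Type*} (σ τ : Perm α) :
    numCycles (σ * τ) = numCycles (τ * σ) := by
  rw [← numCycles_conj (σ * τ) τ]
  congr 1
  group

theorem SameCycle.mul_swap_of_not_sameCycle {α : Type*} [Finite α] [DecidableEq α] {σ : Perm α}
    {a b x y : α} (hxy : SameCycle σ x y) (ha : ¬ SameCycle σ x a) (hb : ¬ SameCycle σ x b) :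
    SameCycle (σ * swap a b) x y := by
  obtain ⟨k, rfl⟩ := hxy.exists_nat_pow_eq
  clear hxy
  induction k with
  | zero => exact SameCycle.refl _ _
  | succ k ih =>
    have hk : SameCycle σ x ((σ ^ k) x) := ⟨k, by simp⟩
    have : (σ ^ (k + 1)) x = (σ * swap a b) ((σ ^ k) x) := by
      rw [mul_apply, swap_apply_of_ne_of_ne, pow_succ', mul_apply]
      · exact fun e => ha (e ▸ hk)
      · exact fun e => hb (e ▸ hk)
    rw [this, sameCycle_apply_right]
    exact ih

section Rotate

variable {q : ℕ}

theorem sameCycle_finRotate (x y : Fin (q + 1)) : SameCycle (finRotate (q + 1)) x y := by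
  have h : ∀ k : ℕ, ∀ hk : k < q + 1, SameCycle (finRotate (q + 1)) 0 ⟨k, hk⟩ := by
    intro k
    induction k with
    | zero => intro _; exact SameCycle.refl _ _
    | succ k ih =>
      intro hk
      have : (⟨k + 1, hk⟩ : Fin (q + 1)) = finRotate (q + 1) ⟨k, by omega⟩ := by
        rw [finRotate_of_lt (by omega)]
      rw [this, sameCycle_apply_right]
      exact ih _
  exact (h x x.2).symm.trans (h y y.2)

theorem numCycles_finRotate : numCycles (finRotate (q + 1)) = 1 := by
  rw [numCycles, Nat.card_eq_one_iff_unique]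
  refine ⟨⟨fun a b => ?_⟩, ⟨Quotient.mk _ 0⟩⟩
  induction a using Quotient.inductionOn
  induction b using Quotient.inductionOn
  exact mk_eq_mk_iff_sameCycle.2 (sameCycle_finRotate _ _)

theorem val_finRotate_of_lt {x y : Fin (q + 1)} (h : x < y) :
    (finRotate (q + 1) x : ℕ) = x + 1 := by
  apply coe_finRotate_of_ne_last
  intro e
  exact absurd h (not_lt.2 (e ▸ Fin.le_last y))

/-- The transposition cuts the full cycle into the arc `(x, z]` and its complement. -/
theorem not_sameCycle_finRotate_mul_swap {x z s t : Fin (q + 1)} (hxz : x < z)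
    (hs : x < s ∧ s ≤ z) (ht : ¬ (x < t ∧ t ≤ z)) :
    ¬ SameCycle (finRotate (q + 1) * swap x z) s t := by
  intro h
  refine ht ((h.mem_iff_of_forall_mem (s := fun t => x < t ∧ t ≤ z) ?_).1 hs)
  rintro t ⟨hxt, htz⟩
  rcases htz.eq_or_lt with rfl | htz
  · rw [mul_apply, swap_apply_right, Fin.lt_def, Fin.le_def, val_finRotate_of_lt hxz]
    rw [Fin.lt_def] at hxz
    omega
  · rw [mul_apply, swap_apply_of_ne_of_ne hxt.ne' htz.ne, Fin.lt_def, Fin.le_def,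
      val_finRotate_of_lt htz]
    rw [Fin.lt_def] at hxt htz
    omega

/-- A permutation is geodesic if it lies on a geodesic from the identity to the full cycle. -/
def IsGeodesic (τ : Perm (Fin (q + 1))) : Prop :=
  numCycles τ + numCycles (τ⁻¹ * finRotate (q + 1)) = q + 2

theorem numCycles_add_numCycles_finRotate_le (τ : Perm (Fin (q + 1))) :
    numCycles τ + numCycles (τ⁻¹ * finRotate (q + 1)) ≤ q + 2 := by
  have := numCycles_add_numCycles_le τ (τ⁻¹ * finRotate (q + 1))
  rw [mul_inv_cancel_left, numCycles_finRotate, Nat.card_fin] at this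
  exact this

theorem IsGeodesic.numCycles_finRotate_mul {τ : Perm (Fin (q + 1))} (h : IsGeodesic τ) :
    numCycles (finRotate (q + 1) * τ) = numEvenCycles τ + 1 := by
  have := (numCycles_mul_mul_of_geodesic τ (τ⁻¹ * finRotate (q + 1)) (by
    rw [mul_inv_cancel_left, numCycles_finRotate, Nat.card_fin, h])).2
  rwa [mul_inv_cancel_left, numCycles_finRotate, add_comm 1] at this

/-- Multiplying `τ` by both transpositions creates two cycles. If `c` and `d` were separated in `γ *
swap a b`, then `γ * swap a b * swap c d` would have a single cycle, and the triangle inequality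
would fail by two. -/
theorem IsGeodesic.sameCycle_mul_swap_finRotate {τ : Perm (Fin (q + 1))} (h : IsGeodesic τ)
    {a b c d : Fin (q + 1)} (hne : a ≠ b) (hab : SameCycle τ a b)
    (hcd : SameCycle (τ * swap a b) c d) : SameCycle (finRotate (q + 1) * swap a b) c d := by
  by_contra hc
  have hcd' : c ≠ d := fun e => hc (e ▸ SameCycle.refl _ _)
  have h1 := numCycles_mul_swap hne hab
  have h2 := numCycles_mul_swap hcd' hcd
  have h3 := numCycles_mul_swap hne (sameCycle_finRotate a b)
  have h4 := numCycles_mul_swap_add_one hc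
  have h5 := numCycles_add_numCycles_le (finRotate (q + 1) * τ⁻¹) (τ * swap a b * swap c d)
  have e : finRotate (q + 1) * τ⁻¹ * (τ * swap a b * swap c d) =
      finRotate (q + 1) * swap a b * swap c d := by group
  rw [e, numCycles_mul_comm _ τ⁻¹, Nat.card_fin] at h5
  rw [numCycles_finRotate] at h3
  unfold IsGeodesic at h
  omega

/-- For a crossing `a < b < c < d`, cutting at `a, c` leaves the cycle of `b, d` in `τ` intact, yet
separates `b` from `d` in the full cycle. -/
theorem IsGeodesic.isNoncrossing {τ : Perm (Fin (q + 1))} (h : IsGeodesic τ) :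
    IsNoncrossing (cyclePartition τ) := by
  intro B hB C hC a ha b hb c hc d hd hab hbc hcd
  by_contra hBC
  have key : ∀ {B : Finset (Fin (q + 1))}, B ∈ (cyclePartition τ).parts → ∀ {x y}, x ∈ B → y ∈ B →
      SameCycle τ x y := fun hB x y hx hy => by
    rw [← mem_part_cyclePartition, (cyclePartition τ).part_eq_of_mem hB hx]
    exact hy
  have hne : ∀ {x y}, x ∈ B → y ∈ C → ¬ SameCycle τ y x := fun {x y} hx hy hs => by
    rw [← mem_part_cyclePartition, (cyclePartition τ).part_eq_of_mem hC hy] at hs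
    exact hBC ((cyclePartition τ).eq_of_mem_parts hB hC hx hs)
  refine not_sameCycle_finRotate_mul_swap (hab.trans hbc) ⟨hab, hbc.le⟩
    (fun hd' => absurd hd'.2 (not_le.2 hcd))
    (h.sameCycle_mul_swap_finRotate (hab.trans hbc).ne (key hB ha hc)
      ((key hC hb hd).mul_swap_of_not_sameCycle (hne ha hb) (hne hc hb)))

/-- A geodesic permutation sends each element to the cyclically next one of its cycle. -/
theorem IsGeodesic.not_cyclically_between {τ : Perm (Fin (q + 1))} (h : IsGeodesic τ)
    {x z : Fin (q + 1)} (hxz : SameCycle τ x z) :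
    ¬ (x < z ∧ z < τ x) ∧ ¬ (z < τ x ∧ τ x < x) ∧ ¬ (τ x < x ∧ x < z) := by
  have key : x ≠ z → SameCycle (finRotate (q + 1) * swap x z) z (τ x) := fun hne => by
    refine h.sameCycle_mul_swap_finRotate hne hxz ?_
    have : τ x = (τ * swap x z) z := by simp
    rw [this, sameCycle_apply_right]
  refine ⟨fun ⟨h1, h2⟩ => ?_, fun ⟨h1, h2⟩ => ?_, fun ⟨h1, h2⟩ => ?_⟩
  · exact not_sameCycle_finRotate_mul_swap h1 ⟨h1, le_rfl⟩ (fun h3 => absurd h3.2 (not_le.2 h2))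
      (key h1.ne)
  · have := key (h1.trans h2).ne'
    rw [swap_comm] at this
    exact not_sameCycle_finRotate_mul_swap (h1.trans h2) ⟨h1, h2.le⟩
      (fun h3 => lt_irrefl _ h3.1) this.symm
  · exact not_sameCycle_finRotate_mul_swap h2 ⟨h2, le_rfl⟩ (fun h3 => absurd h3.1 (not_lt.2 h1.le))
      (key h2.ne)

/-- If the two images of `x` differed, one of them would lie cyclically between `x` and the other,
within the same block. -/
theorem IsGeodesic.eq_of_cyclePartition_eq {σ τ : Perm (Fin (q + 1))} (hσ : IsGeodesic σ)
    (hτ : IsGeodesic τ) (h : cyclePartition σ = cyclePartition τ) : σ = τ := by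
  have hiff : ∀ x y, SameCycle σ x y ↔ SameCycle τ x y := fun x y => by
    rw [← mem_part_cyclePartition, h, mem_part_cyclePartition]
  have hnot : ∀ {σ τ : Perm (Fin (q + 1))}, IsGeodesic σ → IsGeodesic τ →
      (∀ x y, SameCycle σ x y ↔ SameCycle τ x y) → ∀ x, ¬ σ x < τ x := by
    intro σ τ hσ hτ hiff x hlt
    have h1 : SameCycle σ x (τ x) := by rw [hiff, sameCycle_apply_right]
    have h2 : SameCycle τ x (σ x) := by rw [← hiff, sameCycle_apply_right]
    obtain ⟨-, -, s3⟩ := hσ.not_cyclically_between h1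
    obtain ⟨t1, t2, -⟩ := hτ.not_cyclically_between h2
    rcases lt_trichotomy x (σ x) with hx | hx | hx
    · exact t1 ⟨hx, hlt⟩
    · have := h1.eq_of_left hx.symm
      exact hlt.ne (hx.symm.trans this)
    · rcases lt_trichotomy x (τ x) with hy | hy | hy
      · exact s3 ⟨hx, hy⟩
      · have := h2.eq_of_left hy.symm
        exact hx.ne this.symm
      · exact t2 ⟨hlt, hy⟩
  ext x
  exact congrArg Fin.val (le_antisymm
    (not_lt.1 (hnot hτ hσ (fun x y => (hiff x y).symm) x)) (not_lt.1 (hnot hσ hτ hiff x)))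

end Rotate

end Equiv.Perm

/-! ### From noncrossing partitions to geodesics -/

section Successor

open Equiv.Perm

variable {q : ℕ}

/-- The permutation that sends each element to the cyclically next one of its block. -/
theorem Finpartition.exists_perm_next (π : Finpartition (Finset.univ : Finset (Fin q))) :
    ∃ τ : Equiv.Perm (Fin q), (∀ x, π.part (τ x) = π.part x) ∧
      ∀ x, (x < τ x ∧ ∀ z ∈ π.part x, x < z → τ x ≤ z) ∨ ∀ z ∈ π.part x, z ≤ x ∧ τ x ≤ z := by
  have hex : ∀ x, ∃ y ∈ π.part x, (x < y ∧ ∀ z ∈ π.part x, x < z → y ≤ z) ∨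
      ∀ z ∈ π.part x, z ≤ x ∧ y ≤ z := by
    intro x
    by_cases h : ((π.part x).filter (x < ·)).Nonempty
    · have := Finset.min'_mem _ h
      rw [Finset.mem_filter] at this
      exact ⟨_, this.1, Or.inl ⟨this.2, fun z hz hxz =>
        Finset.min'_le _ _ (Finset.mem_filter.2 ⟨hz, hxz⟩)⟩⟩
    · have hne : (π.part x).Nonempty := π.part_nonempty.2 (Finset.mem_univ x)
      refine ⟨_, Finset.min'_mem _ hne, Or.inr fun z hz => ⟨?_, Finset.min'_le _ _ hz⟩⟩
      by_contra hc
      exact h ⟨z, Finset.mem_filter.2 ⟨hz, not_le.1 hc⟩⟩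
  choose f hf hf' using hex
  have hpart : ∀ x, π.part (f x) = π.part x := fun x =>
    (π.mem_part_iff_part_eq_part (Finset.mem_univ _) (Finset.mem_univ _)).1 (hf x)
  have hlt : ∀ x y, f x = f y → ¬ x < y := by
    intro x y hxy hlt
    have hp : π.part x = π.part y := by rw [← hpart x, hxy, hpart]
    have hxm : x ∈ π.part y := by rw [← hp]; exact π.mem_part_self.2 (Finset.mem_univ x)
    have hym : y ∈ π.part x := by rw [hp]; exact π.mem_part_self.2 (Finset.mem_univ y)
    rcases hf' x with ⟨h1, h2⟩ | h1
    · rcases hf' y with ⟨h3, -⟩ | h3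
      · exact absurd (h2 y hym hlt) (not_le.2 (hxy ▸ h3))
      · exact absurd (h3 x hxm).2 (not_le.2 (hxy ▸ h1))
    · exact absurd (h1 y hym).1 (not_le.2 hlt)
  have hinj : Function.Injective f := fun x y h =>
    le_antisymm (not_lt.1 (hlt y x h.symm)) (not_lt.1 (hlt x y h))
  exact ⟨Equiv.ofBijective f (Finite.injective_iff_bijective.1 hinj), hpart, hf'⟩

theorem cyclePartition_eq_of_next {π : Finpartition (Finset.univ : Finset (Fin q))}
    {τ : Equiv.Perm (Fin q)} (hpart : ∀ x, π.part (τ x) = π.part x)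
    (hnext : ∀ x, (x < τ x ∧ ∀ z ∈ π.part x, x < z → τ x ≤ z) ∨ ∀ z ∈ π.part x, z ≤ x ∧ τ x ≤ z) :
    cyclePartition τ = π := by
  have hup : ∀ x y, y ∈ π.part x → x ≤ y → SameCycle τ x y := by
    intro x
    induction x using WellFoundedGT.induction with
    | _ x ih =>
      intro y hy hxy
      rcases hxy.eq_or_lt with rfl | hlt
      · exact SameCycle.refl _ _
      rcases hnext x with ⟨h1, h2⟩ | h1
      · rw [← sameCycle_apply_left]
        exact ih (τ x) h1 y (by rwa [hpart]) (h2 y hy hlt)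
      · exact absurd (h1 y hy).1 (not_le.2 hlt)
  refine Finpartition.ext_part fun x _ => ?_
  ext y
  have hiff := π.mem_part_iff_part_eq_part (a := y) (b := x) (Finset.mem_univ _) (Finset.mem_univ _)
  rw [mem_part_cyclePartition]
  constructor
  · intro h
    rw [hiff]
    exact (h.apply_eq_of_invariant hpart).symm
  · intro h
    rcases le_total x y with hxy | hxy
    · exact hup x y h hxy
    · refine (hup y x ?_ hxy).symm
      rw [hiff.1 h]
      exact π.mem_part_self.2 (Finset.mem_univ x)

/-- Write `y = τ x`; as `y` is not the minimum of its block, `x < y`. The interval `[x, y)` is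
stable under `τ⁻¹ * γ`: a point strictly between `x` and `y` lies in another block, and its
predecessor cannot leave the interval without a crossing. The interval contains `γ⁻¹ y = y - 1`. -/
theorem IsNoncrossing.lt_of_sameCycle {π : Finpartition (Finset.univ : Finset (Fin (q + 1)))}
    (hπ : IsNoncrossing π) {τ : Equiv.Perm (Fin (q + 1))} (hpart : ∀ x, π.part (τ x) = π.part x)
    (hnext : ∀ x, (x < τ x ∧ ∀ z ∈ π.part x, x < z → τ x ≤ z) ∨ ∀ z ∈ π.part x, z ≤ x ∧ τ x ≤ z)
    {y w t : Fin (q + 1)} (hw : w ∈ π.part y) (hwy : w < y)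
    (ht : SameCycle (τ⁻¹ * finRotate (q + 1)) ((finRotate (q + 1))⁻¹ y) t) : t < y := by
  obtain ⟨x, rfl⟩ := τ.surjective y
  rw [hpart] at hw
  obtain ⟨hx, hmin⟩ : x < τ x ∧ ∀ z ∈ π.part x, x < z → τ x ≤ z := by
    rcases hnext x with h | h
    · exact h
    · exact absurd (h w hw).2 (not_le.2 hwy)
  have hmem : ∀ {u v}, π.part u = π.part v → u ∈ π.part v := fun {u v} h => by
    rw [← h]
    exact π.mem_part_self.2 (Finset.mem_univ u)
  have hinv : ∀ t, x ≤ t ∧ t < τ x → x ≤ (τ⁻¹ * finRotate (q + 1)) t ∧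
      (τ⁻¹ * finRotate (q + 1)) t < τ x := by
    rintro t ⟨hxt, htx⟩
    have hval := val_finRotate_of_lt htx
    rw [mul_apply]
    set u := finRotate (q + 1) t
    have hxu : x < u := by rw [Fin.lt_def]; rw [Fin.le_def] at hxt; omega
    have hux : u ≤ τ x := by rw [Fin.le_def]; rw [Fin.lt_def] at htx; omega
    rcases hux.eq_or_lt with hu | hu
    · rw [hu]
      simpa using hx
    have hpu : π.part (τ⁻¹ u) = π.part u := by
      rw [← hpart]; simp
    set v := τ⁻¹ u
    have hne : π.part u ≠ π.part x := fun h => absurd (hmin u (hmem h) hxu) (not_le.2 hu)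
    constructor
    · by_contra! hvx
      exact hne (hπ _ (π.part_mem.2 (Finset.mem_univ u)) _ (π.part_mem.2 (Finset.mem_univ x))
        v (hmem hpu) x (hmem rfl) u (hmem rfl) (τ x) (hmem (hpart x)) hvx hxu hu)
    · by_contra! hvx
      have hne' : τ x ≠ v := fun h => hne (by rw [← hpu, ← h, hpart])
      exact hne (hπ _ (π.part_mem.2 (Finset.mem_univ x)) _ (π.part_mem.2 (Finset.mem_univ u))
        x (hmem rfl) u (hmem rfl) (τ x) (hmem (hpart x)) v (hmem hpu) hxu hu
        (lt_of_le_of_ne hvx hne')).symm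
  refine ((ht.mem_iff_of_forall_mem hinv).1 ?_).2
  set s := (finRotate (q + 1))⁻¹ (τ x) with hs
  have hrs : finRotate (q + 1) s = τ x := by simp [hs]
  have hsl : s ≠ Fin.last q := by
    intro e
    rw [e, finRotate_last] at hrs
    rw [← hrs] at hx
    exact absurd hx (not_lt.2 (Fin.zero_le x))
  have hval := coe_finRotate_of_ne_last hsl
  rw [hrs] at hval
  rw [Fin.lt_def] at hx
  rw [Fin.le_def, Fin.lt_def]
  omega

theorem IsNoncrossing.isGeodesic_of_next {π : Finpartition (Finset.univ : Finset (Fin (q + 1)))}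
    (hπ : IsNoncrossing π) {τ : Equiv.Perm (Fin (q + 1))} (hpart : ∀ x, π.part (τ x) = π.part x)
    (hnext : ∀ x, (x < τ x ∧ ∀ z ∈ π.part x, x < z → τ x ≤ z) ∨ ∀ z ∈ π.part x, z ≤ x ∧ τ x ≤ z) :
    IsGeodesic τ := by
  classical
  refine le_antisymm (numCycles_add_numCycles_finRotate_le τ) ?_
  rw [← card_parts_cyclePartition, cyclePartition_eq_of_next hpart hnext, numCycles]
  let Q := Quotient (SameCycle.setoid (τ⁻¹ * finRotate (q + 1)))
  -- The required `q + 2` blocks and cycles: the minimum of a block gives the block, any other `y`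
  -- gives the cycle in which `y - 1` is the largest point, and `none` gives the cycle of the last
  -- point.
  let f : Option (Fin (q + 1)) → π.parts ⊕ Q := fun o => o.elim (Sum.inr (Quotient.mk _ (Fin.last q)))
    fun y => if ∃ w ∈ π.part y, w < y then Sum.inr (Quotient.mk _ ((finRotate (q + 1))⁻¹ y))
      else Sum.inl ⟨π.part y, π.part_mem.2 (Finset.mem_univ y)⟩
  have hsome : ∀ y y', f (some y) = f (some y') → y ≤ y' := by
    intro y y' h
    by_cases hy : ∃ w ∈ π.part y, w < y <;> by_cases hy' : ∃ w ∈ π.part y', w < y'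
    · simp only [f, Option.elim, hy, hy', if_true, Sum.inr.injEq] at h
      rw [mk_eq_mk_iff_sameCycle] at h
      obtain ⟨w, hw, hwy⟩ := hy'
      have := hπ.lt_of_sameCycle hpart hnext hw hwy h.symm
      obtain ⟨w', hw', hwy'⟩ := hy
      set s := (finRotate (q + 1))⁻¹ y with hs
      have hrs : finRotate (q + 1) s = y := by simp [hs]
      have hval := val_finRotate_of_lt this
      rw [hrs] at hval
      rw [Fin.le_def]
      rw [Fin.lt_def] at this
      omega
    · simp [f, hy, hy'] at h
    · simp [f, hy, hy'] at h
    · simp only [f, Option.elim, hy, hy', if_false, Sum.inl.injEq, Subtype.mk.injEq] at h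
      by_contra! hc
      exact hy ⟨y', by rw [h]; exact π.mem_part_self.2 (Finset.mem_univ _), hc⟩
  have hnone : ∀ y, f (some y) ≠ f none := by
    intro y h
    by_cases hy : ∃ w ∈ π.part y, w < y
    · simp only [f, Option.elim, hy, if_true, Sum.inr.injEq] at h
      rw [mk_eq_mk_iff_sameCycle] at h
      obtain ⟨w, hw, hwy⟩ := hy
      exact absurd (hπ.lt_of_sameCycle hpart hnext hw hwy h) (not_lt.2 (Fin.le_last y))
    · simp [f, hy] at h
  have hinj : Function.Injective f := by
    rintro (_ | y) (_ | y') h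
    · rfl
    · exact absurd h.symm (hnone y')
    · exact absurd h (hnone y)
    · exact congrArg some (le_antisymm (hsome y y' h) (hsome y' y h.symm))
  have := Nat.card_le_card_of_injective f hinj
  rwa [Nat.card_sum, Nat.card_eq_finsetCard, Nat.card_eq_fintype_card, Fintype.card_option,
    Fintype.card_fin] at this

/-- The geodesic permutations correspond to the noncrossing partitions. -/
theorem sum_isGeodesic_eq_sum_NC {M : Type*} [AddCommMonoid M]
    [DecidablePred (IsGeodesic (q := q))] (F : ℕ → ℕ → M) :
    ∑ τ : Equiv.Perm (Fin (q + 1)) with IsGeodesic τ, F (numCycles τ) (numEvenCycles τ) =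
      ∑ π ∈ NC (q + 1), F π.parts.card (evenBlocks π) := by
  refine Finset.sum_bij (fun τ _ => cyclePartition τ) ?_ ?_ ?_ ?_
  · intro τ hτ
    exact Finset.mem_filter.2 ⟨Finset.mem_univ _, (Finset.mem_filter.1 hτ).2.isNoncrossing⟩
  · intro σ hσ τ hτ h
    exact (Finset.mem_filter.1 hσ).2.eq_of_cyclePartition_eq (Finset.mem_filter.1 hτ).2 h
  · intro π hπ
    obtain ⟨τ, hpart, hnext⟩ := π.exists_perm_next
    exact ⟨τ, Finset.mem_filter.2 ⟨Finset.mem_univ _,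
      (Finset.mem_filter.1 hπ).2.isGeodesic_of_next hpart hnext⟩,
      cyclePartition_eq_of_next hpart hnext⟩
  · intro τ _
    rw [card_parts_cyclePartition]
    rfl

end Successor

/-! ### Moments of the standard complex Gaussian law -/

section ComplexGaussian

open Complex ComplexConjugate

theorem integral_stdComplexGaussian {E : Type*} [NormedAddCommGroup E] [NormedSpace ℝ E]
    (f : ℂ → E) :
    ∫ z, f z ∂stdComplexGaussian = ∫ z : ℂ, (Real.pi⁻¹ * Real.exp (-‖z‖ ^ 2)) • f z := by
  have hv : (1 / 2 : ℝ≥0) ≠ 0 := by norm_num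
  have hmap : stdComplexGaussian =
      ((gaussianReal 0 (1 / 2 : ℝ≥0)).prod (gaussianReal 0 (1 / 2 : ℝ≥0))).map
        measurableEquivRealProd.symm := rfl
  rw [hmap, measurableEquivRealProd.symm.measurableEmbedding.integral_map,
    gaussianReal_of_var_ne_zero 0 hv, prod_withDensity (by fun_prop) (by fun_prop),
    integral_withDensity_eq_integral_toReal_smul (by fun_prop)
      (Eventually.of_forall fun x => by simp [gaussianPDF, ENNReal.mul_lt_top]),
    ← Measure.volume_eq_prod,
    ← volume_preserving_equiv_real_prod.integral_comp
      measurableEquivRealProd.measurableEmbedding]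
  refine integral_congr_ae (Eventually.of_forall fun z => ?_)
  simp only [MeasurableEquiv.symm_apply_apply]
  congr 1
  rw [ENNReal.toReal_mul, toReal_gaussianPDF, toReal_gaussianPDF, measurableEquivRealProd_apply,
    gaussianPDFReal_def]
  have hs : (√(2 * Real.pi * ((1 / 2 : ℝ≥0) : ℝ)))⁻¹ * (√(2 * Real.pi * ((1 / 2 : ℝ≥0) : ℝ)))⁻¹ =
      Real.pi⁻¹ := by
    rw [← mul_inv, Real.mul_self_sqrt (by positivity)]
    congr 1
    push_cast
    ring
  have he : Real.exp (-(z.re - 0) ^ 2 / (2 * ((1 / 2 : ℝ≥0) : ℝ))) *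
      Real.exp (-(z.im - 0) ^ 2 / (2 * ((1 / 2 : ℝ≥0) : ℝ))) = Real.exp (-‖z‖ ^ 2) := by
    rw [← Real.exp_add, Complex.sq_norm, Complex.normSq_apply]
    congr 1
    push_cast
    ring
  rw [← hs, ← he]
  ring

theorem integral_stdComplexGaussian_rotate {E : Type*} [NormedAddCommGroup E] [NormedSpace ℝ E]
    (f : ℂ → E) (c : Circle) :
    ∫ z, f (c * z) ∂stdComplexGaussian = ∫ z, f z ∂stdComplexGaussian := by
  have := (rotation c).measurePreserving.integral_comp
    (rotation c).toHomeomorph.measurableEmbedding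
    (fun z : ℂ => (Real.pi⁻¹ * Real.exp (-‖z‖ ^ 2)) • f z)
  rw [integral_stdComplexGaussian, integral_stdComplexGaussian, ← this]
  refine integral_congr_ae (Eventually.of_forall fun z => ?_)
  simp only [rotation_apply]
  rw [norm_mul, show ‖(c : ℂ)‖ = 1 from c.norm_coe, one_mul]

/-- The mixed moments of a standard complex Gaussian variable. -/
theorem integral_pow_mul_conj_pow_stdComplexGaussian (a b : ℕ) :
    ∫ z, z ^ a * conj z ^ b ∂stdComplexGaussian = if a = b then (a.factorial : ℂ) else 0 := by
  split_ifs with h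
  · subst h
    rw [integral_stdComplexGaussian]
    have e : ∀ z : ℂ, (Real.pi⁻¹ * Real.exp (-‖z‖ ^ 2)) • (z ^ a * conj z ^ a) =
        ((Real.pi⁻¹ * (‖z‖ ^ ((2 * a : ℕ) : ℝ) * Real.exp (-‖z‖ ^ (2 : ℝ))) : ℝ) : ℂ) := by
      intro z
      rw [← mul_pow, Complex.mul_conj, Complex.normSq_eq_norm_sq, ← Complex.ofReal_pow,
        Complex.real_smul, ← Complex.ofReal_mul, Real.rpow_natCast, pow_mul, Real.rpow_two]
      congr 1
      ring
    simp_rw [e]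
    have h2 : (-2 : ℝ) < ((2 * a : ℕ) : ℝ) := by
      have : (0 : ℝ) ≤ ((2 * a : ℕ) : ℝ) := Nat.cast_nonneg _
      linarith
    rw [integral_complex_ofReal, integral_const_mul,
      Complex.integral_rpow_mul_exp_neg_rpow one_le_two h2]
    have hG : (((2 * a : ℕ) : ℝ) + 2) / 2 = (a : ℝ) + 1 := by push_cast; ring
    rw [hG, Real.Gamma_nat_eq_factorial]
    have : Real.pi⁻¹ * (2 * Real.pi / 2 * (a.factorial : ℝ)) = (a.factorial : ℝ) := by
      field_simp
    rw [this, Complex.ofReal_natCast]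
  · have hab : ((a : ℂ) - b) ≠ 0 := sub_ne_zero.2 (by exact_mod_cast h)
    have hab' : ((a : ℝ) - b) ≠ 0 := sub_ne_zero.2 (by exact_mod_cast h)
    -- Rotation by this angle multiplies the integrand by `-1`, so the integral equals its own
    -- opposite.
    set c := Circle.exp (Real.pi / ((a : ℝ) - b)) with hc
    have hcc : (c : ℂ) ^ a * conj (c : ℂ) ^ b = -1 := by
      rw [hc, Circle.coe_exp, ← Complex.exp_conj, ← Complex.exp_nat_mul, ← Complex.exp_nat_mul,
        ← Complex.exp_add, ← Complex.exp_pi_mul_I]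
      congr 1
      simp only [map_mul, Complex.conj_ofReal, Complex.conj_I]
      push_cast
      field_simp
      ring
    have h1 := integral_stdComplexGaussian_rotate (fun z : ℂ => z ^ a * conj z ^ b) c
    have h2 : ∀ z : ℂ, ((c : ℂ) * z) ^ a * conj ((c : ℂ) * z) ^ b = -(z ^ a * conj z ^ b) := by
      intro z
      rw [map_mul, mul_pow, mul_pow, mul_mul_mul_comm, hcc, neg_one_mul]
    simp_rw [h2] at h1
    rw [integral_neg] at h1
    exact self_eq_neg.1 h1.symm

theorem memLp_id_stdComplexGaussian (r : ℝ≥0) : MemLp id r stdComplexGaussian := by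
  have hre : MemLp (fun x : ℝ × ℝ => (x.1 : ℂ)) r
      ((gaussianReal 0 (1 / 2 : ℝ≥0)).prod (gaussianReal 0 (1 / 2 : ℝ≥0))) :=
    ((memLp_id_gaussianReal r).comp_fst _).ofReal
  have him : MemLp (fun x : ℝ × ℝ => (x.2 : ℂ)) r
      ((gaussianReal 0 (1 / 2 : ℝ≥0)).prod (gaussianReal 0 (1 / 2 : ℝ≥0))) :=
    ((memLp_id_gaussianReal r).comp_snd _).ofReal
  have hmap : stdComplexGaussian =
      ((gaussianReal 0 (1 / 2 : ℝ≥0)).prod (gaussianReal 0 (1 / 2 : ℝ≥0))).map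
        measurableEquivRealProd.symm := rfl
  rw [hmap, measurableEquivRealProd.symm.measurableEmbedding.memLp_map_measure_iff]
  refine (hre.add (him.mul_const I)).congr_norm (by fun_prop) (Eventually.of_forall fun x => ?_)
  simp [measurableEquivRealProd_symm_apply, Complex.mk_eq_add_mul_I]

end ComplexGaussian

/-! ### Wick's formula -/

section Wick

open ComplexConjugate

variable {α I : Type*} [Fintype α]

/-- When the fibers match, the solutions form a coset of the stabilizer of `u`, a product of
symmetric groups on the fibers. The factors are the mixed moments of a single Gaussian. -/
theorem card_perm_comp_eq [DecidableEq α] [Fintype I] [DecidableEq I] (u v : α → I) :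
    Fintype.card {τ : Equiv.Perm α // u ∘ τ = v} =
      ∏ i, if Fintype.card {s // u s = i} = Fintype.card {s // v s = i}
        then (Fintype.card {s // u s = i}).factorial else 0 := by
  by_cases h : ∀ i, Fintype.card {s // u s = i} = Fintype.card {s // v s = i}
  · let τ₀ : Equiv.Perm α := Equiv.ofFiberEquiv (f := v) (g := u) fun i =>
      (Fintype.equivOfCardEq (h i)).symm
    have hτ₀ : u ∘ τ₀ = v := funext fun s => Equiv.ofFiberEquiv_map _ s
    have hτ₀' : v ∘ (τ₀⁻¹ : Equiv.Perm α) = u := by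
      rw [← hτ₀]; ext s; simp
    rw [Finset.prod_congr rfl fun i _ => if_pos (h i), ← DomMulAct.stabilizer_card u]
    refine Fintype.card_congr ((Equiv.mulRight τ₀⁻¹).subtypeEquiv fun τ => ?_)
    constructor
    · intro hτ
      rw [Equiv.coe_mulRight, Equiv.Perm.coe_mul, ← Function.comp_assoc, hτ, hτ₀']
    · intro hτ
      rw [Equiv.coe_mulRight, Equiv.Perm.coe_mul, ← Function.comp_assoc] at hτ
      rw [← hτ₀]
      conv_rhs => rw [← hτ]
      ext s
      simp
  · push Not at h
    obtain ⟨i, hi⟩ := h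
    rw [Finset.prod_eq_zero (Finset.mem_univ i) (if_neg hi), Fintype.card_eq_zero_iff]
    refine ⟨fun ⟨τ, hτ⟩ => hi (Fintype.card_congr (τ.subtypeEquiv fun s => ?_)).symm⟩
    rw [← hτ]
    rfl

theorem prod_comp_eq_prod_pow_card [Fintype I] [DecidableEq I] {M : Type*}
    [CommMonoid M] (u : α → I) (f : I → M) :
    ∏ s, f (u s) = ∏ i, f i ^ Fintype.card {s // u s = i} := by
  rw [← Finset.prod_fiberwise Finset.univ u]
  refine Finset.prod_congr rfl fun i _ => ?_
  rw [Finset.prod_congr rfl (g := fun _ => f i), Finset.prod_const, Fintype.card_subtype]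
  intro s hs
  rw [(Finset.mem_filter.1 hs).2]

variable {Ω : Type*} [MeasurableSpace Ω] {P : Measure Ω} {X : I → Ω → ℂ}

theorem memLp_of_hasLaw_stdComplexGaussian {X : Ω → ℂ} (hX : HasLaw X stdComplexGaussian P)
    (r : ℝ≥0) : MemLp X r P := by
  have := memLp_id_stdComplexGaussian r
  rw [← hX.map_eq] at this
  exact (memLp_map_measure_iff this.1 hX.aemeasurable).1 this

theorem integrable_prod_mul_conj [IsFiniteMeasure P]
    (hX : ∀ i, HasLaw (X i) stdComplexGaussian P) (u v : α → I) :
    Integrable (fun ω => ∏ s, (X (u s) ω * conj (X (v s) ω))) P := by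
  let r : ℝ≥0 := 2 * Fintype.card α + 1
  have hmem : ∀ i, MemLp (fun ω => conj (X i ω)) r P := fun i =>
    (memLp_of_hasLaw_stdComplexGaussian (hX i) r).star
  have h1 : ∀ s : α ⊕ α, MemLp (fun ω => s.elim (fun s => X (u s) ω)
      fun s => conj (X (v s) ω)) r P := by
    rintro (s | s)
    · exact memLp_of_hasLaw_stdComplexGaussian (hX _) r
    · exact hmem _
  -- Hölder's inequality for `2 * |α|` factors in `L^r`; the reciprocal exponents add up to `2 * |α|
  -- / r ≤ 1`.
  have h2 := MemLp.prod' (s := Finset.univ) fun s _ => h1 s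
  have h3 := h2.mono_exponent (p := 1) (by
    rw [ENNReal.one_le_inv, Finset.sum_const, Finset.card_univ, Fintype.card_sum, nsmul_eq_mul,
      ← div_eq_mul_inv]
    refine ENNReal.div_le_of_le_mul ?_
    rw [one_mul]
    simp only [r]
    push_cast
    rw [← two_mul]
    exact le_self_add)
  rw [memLp_one_iff_integrable] at h3
  simpa [Finset.prod_mul_distrib] using h3

/-- Wick's formula for independent standard complex Gaussian variables. -/
theorem integral_prod_mul_conj [DecidableEq α] [Fintype I] [DecidableEq I]
    (hX : ∀ i, HasLaw (X i) stdComplexGaussian P) (hind : iIndepFun X P) (u v : α → I) :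
    ∫ ω, ∏ s, (X (u s) ω * conj (X (v s) ω)) ∂P =
      Fintype.card {τ : Equiv.Perm α // u ∘ τ = v} := by
  have e : ∀ ω, ∏ s, (X (u s) ω * conj (X (v s) ω)) = ∏ i,
      (fun z : ℂ => z ^ Fintype.card {s // u s = i} * conj z ^ Fintype.card {s // v s = i})
        (X i ω) := by
    intro ω
    rw [Finset.prod_mul_distrib, prod_comp_eq_prod_pow_card u fun i => X i ω,
      prod_comp_eq_prod_pow_card v fun i => conj (X i ω), ← Finset.prod_mul_distrib]
  simp_rw [e]
  rw [hind.integral_fun_prod_comp (fun i => (hX i).aemeasurable)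
    (f := fun i (z : ℂ) => z ^ Fintype.card {s // u s = i} * conj z ^ Fintype.card {s // v s = i})
    (fun i => (by fun_prop : Continuous _).aestronglyMeasurable), card_perm_comp_eq]
  push_cast
  refine Finset.prod_congr rfl fun i _ => ?_
  rw [← integral_pow_mul_conj_pow_stdComplexGaussian, ← (hX i).map_eq,
    integral_map (hX i).aemeasurable (by fun_prop : Continuous _).aestronglyMeasurable]

end Wick

/-! ### Traces of powers as sums over closed paths -/

section TracePow

theorem Matrix.pow_succ_apply_eq_sum {ι R : Type*} [Fintype ι] [DecidableEq ι] [CommSemiring R]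
    (A : Matrix ι ι R) (k : ℕ) (x y : ι) :
    (A ^ (k + 1)) x y = ∑ g : Fin k → ι, ∏ s : Fin (k + 1),
      A ((Fin.cons x g : Fin (k + 1) → ι) s) ((Fin.snoc g y : Fin (k + 1) → ι) s) := by
  induction k generalizing x with
  | zero => simp [Fin.snoc]
  | succ k ih =>
    rw [pow_succ', Matrix.mul_apply, ← (Fin.consEquiv fun _ : Fin (k + 1) => ι).sum_comp,
      Fintype.sum_prod_type]
    refine Finset.sum_congr rfl fun z _ => ?_
    rw [ih, Finset.mul_sum]
    refine Finset.sum_congr rfl fun g _ => ?_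
    rw [Fin.prod_univ_succ (n := k + 1)]
    have e : (Fin.snoc (Fin.cons z g : Fin (k + 1) → ι) y : Fin (k + 2) → ι) =
        Fin.cons z (Fin.snoc g y : Fin (k + 1) → ι) :=
      (Fin.cons_snoc_eq_snoc_cons (β := ι) z g y).symm
    change _ = A x ((Fin.snoc (Fin.cons z g : Fin (k + 1) → ι) y : Fin (k + 2) → ι) 0) *
      ∏ s : Fin (k + 1), A ((Fin.cons z g : Fin (k + 1) → ι) s)
        ((Fin.snoc (Fin.cons z g : Fin (k + 1) → ι) y : Fin (k + 2) → ι) s.succ)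
    simp only [e, Fin.cons_zero, Fin.cons_succ]

theorem Matrix.trace_pow_succ {ι R : Type*} [Fintype ι] [DecidableEq ι] [CommSemiring R]
    (A : Matrix ι ι R) (k : ℕ) :
    (A ^ (k + 1)).trace =
      ∑ f : Fin (k + 1) → ι, ∏ s, A (f s) (f (finRotate (k + 1) s)) := by
  rw [← (Fin.consEquiv fun _ : Fin (k + 1) => ι).sum_comp, Fintype.sum_prod_type, Matrix.trace]
  refine Finset.sum_congr rfl fun x _ => ?_
  rw [Matrix.diag_apply, Matrix.pow_succ_apply_eq_sum]
  refine Finset.sum_congr rfl fun g _ => Finset.prod_congr rfl fun s _ => ?_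
  rw [Fin.snoc_eq_cons_rotate]
  rfl

end TracePow

/-! ### Counting index families -/

section IndexCount

open Equiv.Perm

variable {α D N K : Type*} [Fintype α]

/-- The substitution `f ↦ f ∘ τ` turns the condition into invariance under `τ⁻¹ * γ`. -/
theorem card_functions_comp_eq_comp (γ τ : Equiv.Perm α) :
    Nat.card {f : α → D // f ∘ τ = f ∘ γ} = Nat.card D ^ numCycles (τ⁻¹ * γ) := by
  rw [← card_invariant_functions]
  refine Nat.card_congr ((Equiv.arrowCongr τ⁻¹ (Equiv.refl D)).subtypeEquiv fun f => ?_)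
  have h1 : (Equiv.arrowCongr τ⁻¹ (Equiv.refl D)) f = f ∘ τ := rfl
  have h2 : (f ∘ τ) ∘ (τ⁻¹ * γ : Equiv.Perm α) = f ∘ γ := by
    ext s; simp
  rw [h1, h2, eq_comm]

/-- The number of index families that contribute to the pairing `τ` in the expansion of the trace of
a power of the partial transpose. -/
theorem card_index_families (γ τ : Equiv.Perm α) :
    Nat.card {f : (α → D × N) × (α → K) //
      (fun s => (((f.1 s).1, (f.1 (γ s)).2), f.2 s)) ∘ τ =
        fun s => (((f.1 (γ s)).1, (f.1 s).2), f.2 s)} =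
      Nat.card D ^ numCycles (τ⁻¹ * γ) * Nat.card N ^ numCycles (γ * τ) *
        Nat.card K ^ numCycles τ := by
  -- The constraints decouple: `f ∘ τ = f ∘ γ` on the `D` indices, invariance under `γ * τ` on the
  -- `N` indices (the partial transpose moves `γ` to the other side), and invariance under `τ` on
  -- the `K` indices.
  rw [← card_functions_comp_eq_comp, ← card_invariant_functions, ← card_invariant_functions,
    ← Nat.card_prod, ← Nat.card_prod]
  refine Nat.card_congr
    { toFun := fun f => ((⟨fun s => (f.1.1 s).1, ?_⟩, ⟨fun s => (f.1.1 s).2, ?_⟩), ⟨f.1.2, ?_⟩)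
      invFun := fun g => ⟨(fun s => (g.1.1.1 s, g.1.2.1 s), g.2.1), ?_⟩
      left_inv := fun f => rfl
      right_inv := fun g => rfl }
  · exact funext fun s => congrArg (fun t => t.1.1) (congrFun f.2 s)
  · exact funext fun s => congrArg (fun t => t.1.2) (congrFun f.2 s)
  · exact funext fun s => congrArg (fun t => t.2) (congrFun f.2 s)
  · exact funext fun s => Prod.ext (Prod.ext (congrFun g.1.1.2 s) (congrFun g.1.2.2 s))
      (congrFun g.2.2 s)

end IndexCount

/-! ### Exact moments for fixed dimension -/

section Expectation

open ComplexConjugate Equiv.Perm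

theorem normalizedTrace_partialTranspose_wishart_pow {d n κ : Type*} [Fintype d] [DecidableEq d]
    [Fintype n] [DecidableEq n] [Fintype κ] (c : ℂ) (G : Matrix (d × n) κ ℂ) (q : ℕ) :
    normalizedTrace ((c • partialTranspose (wishart G)) ^ (q + 1)) =
      (Fintype.card (d × n) : ℂ)⁻¹ * (c * (Fintype.card κ : ℂ)⁻¹) ^ (q + 1) *
      ∑ f : (Fin (q + 1) → d × n) × (Fin (q + 1) → κ), ∏ s,
        (G ((f.1 s).1, (f.1 (finRotate (q + 1) s)).2) (f.2 s) *
          conj (G ((f.1 (finRotate (q + 1) s)).1, (f.1 s).2) (f.2 s))) := by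
  rw [normalizedTrace, Matrix.trace_pow_succ, mul_assoc, Fintype.sum_prod_type]
  congr 1
  rw [Finset.mul_sum]
  refine Finset.sum_congr rfl fun f _ => ?_
  have e : ∀ x y, (c • partialTranspose (wishart G)) x y =
      (c * (Fintype.card κ : ℂ)⁻¹) * ∑ k, G (x.1, y.2) k * conj (G (y.1, x.2) k) := by
    intro x y
    simp [partialTranspose, wishart, Matrix.mul_apply, Matrix.conjTranspose_apply, mul_assoc]
  simp_rw [e]
  rw [Finset.prod_mul_distrib, Finset.prod_const, Finset.card_univ, Fintype.card_fin,
    Finset.prod_univ_sum, Fintype.piFinset_univ]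

variable {Ω d n κ : Type*} [MeasurableSpace Ω] {P : Measure Ω} [Fintype d] [DecidableEq d]
  [Fintype n] [DecidableEq n] [Fintype κ] {G : Ω → Matrix (d × n) κ ℂ}

theorem integrable_normalizedTrace_partialTranspose_wishart_pow [IsFiniteMeasure P]
    (hG : IsComplexGaussianMatrix G P) (c : ℂ) (q : ℕ) :
    Integrable (fun ω => normalizedTrace ((c • partialTranspose (wishart (G ω))) ^ (q + 1))) P := by
  simp_rw [normalizedTrace_partialTranspose_wishart_pow]
  refine Integrable.const_mul (integrable_finsetSum _ fun f _ => ?_) _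
  exact integrable_prod_mul_conj (X := fun (ij : (d × n) × κ) (ω : Ω) => G ω ij.1 ij.2)
    (fun ij => hG.hasLaw ij.1 ij.2)
    (fun s => (((f.1 s).1, (f.1 (finRotate (q + 1) s)).2), f.2 s))
    (fun s => (((f.1 (finRotate (q + 1) s)).1, (f.1 s).2), f.2 s))

/-- The moments of the partial transpose of a complex Wishart matrix, as a sum over permutations. -/
theorem integral_normalizedTrace_partialTranspose_wishart_pow [DecidableEq κ] [IsFiniteMeasure P]
    (hG : IsComplexGaussianMatrix G P) (c : ℂ) (q : ℕ) :
    ∫ ω, normalizedTrace ((c • partialTranspose (wishart (G ω))) ^ (q + 1)) ∂P =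
      (Fintype.card (d × n) : ℂ)⁻¹ * (c * (Fintype.card κ : ℂ)⁻¹) ^ (q + 1) *
      ∑ τ : Equiv.Perm (Fin (q + 1)),
        (Fintype.card d : ℂ) ^ numCycles (τ⁻¹ * finRotate (q + 1)) *
          (Fintype.card n : ℂ) ^ numCycles (finRotate (q + 1) * τ) *
          (Fintype.card κ : ℂ) ^ numCycles τ := by
  simp_rw [normalizedTrace_partialTranspose_wishart_pow]
  rw [integral_const_mul, integral_finsetSum]
  swap
  · intro f _
    exact integrable_prod_mul_conj (X := fun (ij : (d × n) × κ) (ω : Ω) => G ω ij.1 ij.2)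
      (fun ij => hG.hasLaw ij.1 ij.2)
      (fun s => (((f.1 s).1, (f.1 (finRotate (q + 1) s)).2), f.2 s))
      (fun s => (((f.1 (finRotate (q + 1) s)).1, (f.1 s).2), f.2 s))
  congr 1
  have hwick := fun f : (Fin (q + 1) → d × n) × (Fin (q + 1) → κ) =>
    integral_prod_mul_conj (X := fun (ij : (d × n) × κ) (ω : Ω) => G ω ij.1 ij.2)
      (fun ij => hG.hasLaw ij.1 ij.2) hG.indep
      (fun s => (((f.1 s).1, (f.1 (finRotate (q + 1) s)).2), f.2 s))
      (fun s => (((f.1 (finRotate (q + 1) s)).1, (f.1 s).2), f.2 s))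
  rw [Finset.sum_congr rfl fun f _ => hwick f]
  have hcount := fun τ : Equiv.Perm (Fin (q + 1)) =>
    card_index_families (D := d) (N := n) (K := κ) (finRotate (q + 1)) τ
  simp only [Nat.card_eq_fintype_card] at hcount
  have hcast : ∀ τ : Equiv.Perm (Fin (q + 1)),
      (Fintype.card d : ℂ) ^ numCycles (τ⁻¹ * finRotate (q + 1)) *
          (Fintype.card n : ℂ) ^ numCycles (finRotate (q + 1) * τ) *
          (Fintype.card κ : ℂ) ^ numCycles τ =
      ((Fintype.card d ^ numCycles (τ⁻¹ * finRotate (q + 1)) *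
          Fintype.card n ^ numCycles (finRotate (q + 1) * τ) *
          Fintype.card κ ^ numCycles τ : ℕ) : ℂ) := fun τ => by push_cast; rfl
  rw [Finset.sum_congr rfl fun τ _ => hcast τ, Finset.sum_congr rfl fun τ _ =>
    congrArg (Nat.cast (R := ℂ)) (hcount τ).symm]
  simp only [Fintype.card_subtype, Finset.card_filter]
  push_cast
  exact Finset.sum_comm

end Expectation

/-! ### The limit of large dimension -/

section Limit

open Equiv.Perm

theorem tendsto_pow_mul_inv_pow_of_le {a b : ℕ} (h : a ≤ b) :
    Tendsto (fun d : ℕ => (d : ℂ) ^ a * ((d : ℂ)⁻¹) ^ b) atTop (𝓝 (if a = b then 1 else 0)) := by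
  have e : ∀ᶠ d : ℕ in atTop, ((d : ℂ)⁻¹) ^ (b - a) = (d : ℂ) ^ a * ((d : ℂ)⁻¹) ^ b := by
    filter_upwards [eventually_ge_atTop 1] with d hd
    have hd' : (d : ℂ) ≠ 0 := by exact_mod_cast (by omega : d ≠ 0)
    obtain ⟨k, rfl⟩ := Nat.exists_eq_add_of_le h
    rw [Nat.add_sub_cancel_left, pow_add, ← mul_assoc, ← mul_pow, mul_inv_cancel₀ hd', one_pow,
      one_mul]
  refine Tendsto.congr' e ?_
  split_ifs with hab
  · simp [hab]
  · have h0 : b - a ≠ 0 := by omega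
    have := (tendsto_inv_atTop_nhds_zero_nat (𝕜 := ℂ)).pow (b - a)
    rwa [zero_pow h0] at this

end Limit

theorem theorem1p2 (m n : ℕ) (hm : 1 ≤ m) (hn : 1 ≤ n)
    {Ω : ℕ → Type*} [∀ d, MeasurableSpace (Ω d)] (P : ∀ d, Measure (Ω d))
    [∀ d, IsProbabilityMeasure (P d)]
    (G : ∀ d, Ω d → Matrix (Fin d × Fin n) (Fin d × Fin m) ℂ)
    (hG : ∀ d, IsComplexGaussianMatrix (G d) (P d))
    (p : ℕ) (hp : 1 ≤ p) :
    (∀ d, Integrable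
      (fun ω => normalizedTrace (((m : ℂ) • partialTranspose (wishart (G d ω))) ^ p)) (P d)) ∧
    Tendsto
      (fun d => ∫ ω, normalizedTrace (((m : ℂ) • partialTranspose (wishart (G d ω))) ^ p) ∂(P d))
      atTop
      (𝓝 (∑ π ∈ NC p, (m : ℂ) ^ π.parts.card * (n : ℂ) ^ evenBlocks π)) := by
  classical
  obtain ⟨q, rfl⟩ := Nat.exists_eq_add_of_le' hp
  have hm0 : (m : ℂ) ≠ 0 := by exact_mod_cast (by omega : m ≠ 0)
  have hn0 : (n : ℂ) ≠ 0 := by exact_mod_cast (by omega : n ≠ 0)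
  refine ⟨fun d => integrable_normalizedTrace_partialTranspose_wishart_pow (hG d) m q, ?_⟩
  have hE : ∀ d, ∫ ω, normalizedTrace
      (((m : ℂ) • partialTranspose (wishart (G d ω))) ^ (q + 1)) ∂(P d) =
      ∑ τ : Equiv.Perm (Fin (q + 1)),
        ((m : ℂ) ^ τ.numCycles * ((n : ℂ)⁻¹ * (n : ℂ) ^ (finRotate (q + 1) * τ).numCycles)) *
        ((d : ℂ) ^ (τ.numCycles + (τ⁻¹ * finRotate (q + 1)).numCycles) * ((d : ℂ)⁻¹) ^ (q + 2)) := by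
    intro d
    -- This also holds for `d = 0`, where both sides vanish, so the formula needs no case split on
    -- `d`.
    have hc : (m : ℂ) * ((d : ℂ) * m)⁻¹ = (d : ℂ)⁻¹ := by
      rw [mul_inv, mul_comm, mul_assoc, inv_mul_cancel₀ hm0, mul_one]
    rw [integral_normalizedTrace_partialTranspose_wishart_pow (hG d), Finset.mul_sum]
    refine Finset.sum_congr rfl fun τ _ => ?_
    simp only [Fintype.card_prod, Fintype.card_fin, Nat.cast_mul]
    rw [hc, mul_inv, mul_pow, pow_add (d : ℂ), pow_succ _ (q + 1)]
    ring
  simp_rw [hE]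
  have hlim := tendsto_finsetSum (Finset.univ : Finset (Equiv.Perm (Fin (q + 1)))) fun τ _ =>
    (tendsto_pow_mul_inv_pow_of_le (τ.numCycles_add_numCycles_finRotate_le)).const_mul
      ((m : ℂ) ^ τ.numCycles * ((n : ℂ)⁻¹ * (n : ℂ) ^ (finRotate (q + 1) * τ).numCycles))
  convert hlim using 2
  -- The terms with limit factor `1` are the geodesic ones; there `n⁻¹` cancels the extra `n` in `n
  -- ^ (e(τ) + 1)`.
  rw [← sum_isGeodesic_eq_sum_NC fun a b => (m : ℂ) ^ a * (n : ℂ) ^ b, Finset.sum_filter]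
  refine Finset.sum_congr rfl fun τ _ => ?_
  by_cases h : τ.IsGeodesic
  · have h' := h
    unfold Equiv.Perm.IsGeodesic at h'
    rw [if_pos h, if_pos h', h.numCycles_finRotate_mul, pow_succ', inv_mul_cancel_left₀ hn0, mul_one]
  · have h' := h
    unfold Equiv.Perm.IsGeodesic at h'
    rw [if_neg h, if_neg h', mul_zero]
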